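/- All manifolds are smooth, finite-dimensional, Hausdorff and second countable. A \emph{Dirac manifold} $(M,L)$ is a manifold $M$ with a Dirac structure, i.e. a subbundle $L\subset TM\oplus T^*M$ that is maximally isotropic for $\langle X+\alpha,Y+\beta\rangle_+=\tfrac12(\beta(X)+\alpha(Y))$ and whose sections are closed under the Courant bracket $[X+\alpha,Y+\beta]=[X,Y]+\mathcal L_X\beta-\mathcal L_Y\alpha+\tfrac12 d(\alpha(Y)-\beta(X))$. Let $D_L=L\cap TM$ be its characteristic distribution and $\mathcal F_L$ the corresponding foliation. $(M,L)$ is \emph{reducible} if $D_L$ has constant rank and $\mathcal F_L$ is simple, i.e. the leaf space $M/\mathcal F_L$ is a smooth manifold, the projection $p:M\to M/\mathcal F_L$ (whose fibres are the leaves) is a submersion, and $\ker dp=D_L$. A smooth map $\phi:M\to N$ is a \emph{b-Dirac map} with respect to subbundles $L\subset TM\oplus T^*M$ and $K\subset TN\oplus T^*N$ if $L=\mathcal B_\phi(K)$, where $\mathcal B_\phi(K)_x=\{X+\phi^*\alpha : \phi_*X+\alpha\in K_{\phi(x)}\}$ for $x\in M$. \textbf{Proposition.} Let $(M,L)$ and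 $(N,K)$ be reducible Dirac manifolds. Then there is a unique Poisson bracket on $C^\infty(M/\mathcal F_L)$ (the reduced Poisson structure) such that for all $f,g\in C^\infty(M/\mathcal F_L)$ there is a vector field $X$ on $M$ with $X+d(f\circ p)\in\Gamma(L)$ and, for each such $X$, $\{f,g\}\circ p=X(g\circ p)$; likewise for $(N,K)$. Let $\phi:(M,L)\to(N,K)$ be a b-Dirac map that maps every leaf of $\mathcal F_L$ into a leaf of $\mathcal F_K$. Then the induced map $\bar\phi:M/\mathcal F_L\to N/\mathcal F_K$ is smooth and is a b-Dirac map between the graphs of the reduced Poisson structures: \[ \mathcal B_{\bar\phi}\big(L_{\pi_{N/\mathcal F_K}}\big)=L_{\pi_{M/\mathcal F_L}}, \] where $L_\pi=\{\pi^\sharp\alpha+\alpha\}$ is the graph of the bivector $\pi$ given by $\pi(df,dg)=\{f,g\}$, with $\langle\pi^\sharp\alpha,\beta\rangle=\pi(\alpha,\beta)$. -/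

import Mathlib

open scoped Manifold ContDiff Topology
open Bundle

namespace DiracGeometry

noncomputable section

section Basic

variable {E : Type*} [NormedAddCommGroup E] [NormedSpace ℝ E]
  {M : Type*} [TopologicalSpace M] [ChartedSpace E M]

/-- The fibre `T_x M ⊕ T_x^* M` of the generalized tangent bundle; `X + α` is the pair `(X, α)`. -/
abbrev GenTangentSpace (E : Type*) [NormedAddCommGroup E] [NormedSpace ℝ E]
    {M : Type*} [TopologicalSpace M] [ChartedSpace E M] (x : M) : Type _ :=
  TangentSpace 𝓘(ℝ, E) x × (TangentSpace 𝓘(ℝ, E) x →L[ℝ] ℝ)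

/-- The differential at `x` of a real function, as a covector. -/
def dAt (E : Type*) [NormedAddCommGroup E] [NormedSpace ℝ E]
    {M : Type*} [TopologicalSpace M] [ChartedSpace E M] (f : M → ℝ) (x : M) :
    TangentSpace 𝓘(ℝ, E) x →L[ℝ] ℝ :=
  mfderiv 𝓘(ℝ, E) 𝓘(ℝ, ℝ) f x

/-- The symmetric pairing `⟨X + α, Y + β⟩₊ = (β(X) + α(Y)) / 2`. -/
def symmPairing {x : M} (u w : GenTangentSpace E x) : ℝ :=
  (1 / 2) * (w.2 u.1 + u.2 w.1)

/-- A linear subspace of `T_x M ⊕ T_x^* M` is isotropic if the symmetric pairing vanishes on it. -/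
def IsIsotropic {x : M} (S : Submodule ℝ (GenTangentSpace E x)) : Prop :=
  ∀ u ∈ S, ∀ w ∈ S, symmPairing u w = 0

/-- The Lie derivative of a 1-form `β` along `X`, evaluated on the vector field `W`:
`(L_X β)(W) = X (β(W)) - β([X, W])`. -/
def lieDerivForm (X : ∀ x : M, TangentSpace 𝓘(ℝ, E) x)
    (β : ∀ x : M, TangentSpace 𝓘(ℝ, E) x →L[ℝ] ℝ)
    (W : ∀ x : M, TangentSpace 𝓘(ℝ, E) x) (x : M) : ℝ :=
  dAt E (fun y => β y (W y)) x (X x) - β x (VectorField.mlieBracket 𝓘(ℝ, E) X W x)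

/-- The 1-form component `L_X β - L_Y α + d(α(Y) - β(X)) / 2` of the Courant bracket
of `X + α` and `Y + β`, evaluated on the vector field `W`. -/
def courantForm (X : ∀ x : M, TangentSpace 𝓘(ℝ, E) x)
    (α : ∀ x : M, TangentSpace 𝓘(ℝ, E) x →L[ℝ] ℝ)
    (Y : ∀ x : M, TangentSpace 𝓘(ℝ, E) x)
    (β : ∀ x : M, TangentSpace 𝓘(ℝ, E) x →L[ℝ] ℝ)
    (W : ∀ x : M, TangentSpace 𝓘(ℝ, E) x) (x : M) : ℝ :=
  lieDerivForm X β W x - lieDerivForm Y α W x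
    + (1 / 2) * dAt E (fun y => α y (Y y) - β y (X y)) x (W x)

/-- The characteristic distribution `D_L = L ∩ TM`. -/
def charDistribution (L : ∀ x : M, Submodule ℝ (GenTangentSpace E x)) (x : M) :
    Submodule ℝ (TangentSpace 𝓘(ℝ, E) x) :=
  (L x).comap (LinearMap.inl ℝ (TangentSpace 𝓘(ℝ, E) x) (TangentSpace 𝓘(ℝ, E) x →L[ℝ] ℝ))

/-- `γ` is a smooth curve tangent to the characteristic distribution of `L`. -/
def IsTangentCurve (L : ∀ x : M, Submodule ℝ (GenTangentSpace E x)) (γ : ℝ → M) : Prop :=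
  ContMDiff 𝓘(ℝ, ℝ) 𝓘(ℝ, E) ∞ γ ∧
    ∀ t : ℝ, mfderiv 𝓘(ℝ, ℝ) 𝓘(ℝ, E) γ t (1 : ℝ) ∈ charDistribution L (γ t)

/-- The equivalence relation "lying on the same leaf of the characteristic foliation": it is
generated by joining points by smooth curves tangent to the characteristic distribution. -/
def leafSetoid (L : ∀ x : M, Submodule ℝ (GenTangentSpace E x)) : Setoid M :=
  Relation.EqvGen.setoid fun x y => ∃ γ : ℝ → M, IsTangentCurve L γ ∧ γ 0 = x ∧ γ 1 = y

/-- The leaf space `M / 𝓕_L` of the characteristic foliation, with the quotient topology. -/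
def LeafSpace (L : ∀ x : M, Submodule ℝ (GenTangentSpace E x)) : Type _ :=
  Quotient (leafSetoid L)

instance (L : ∀ x : M, Submodule ℝ (GenTangentSpace E x)) : TopologicalSpace (LeafSpace L) :=
  inferInstanceAs (TopologicalSpace (Quotient (leafSetoid L)))

/-- The projection `p : M → M / 𝓕_L`. -/
def leafProj (L : ∀ x : M, Submodule ℝ (GenTangentSpace E x)) : M → LeafSpace L :=
  Quotient.mk (leafSetoid L)

/-- A family of subspaces `L` is reducible, with respect to a given manifold structure on the leaf
space `M / 𝓕_L`, if the characteristic distribution has constant rank and the characteristic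
foliation is simple, i.e. it is the foliation defined by the submersion `p : M → M / 𝓕_L`:
the leaves of `𝓕_L` are the fibres of `p`, and their tangent spaces, which make up `D_L`,
are the kernels of the differential of `p`. -/
structure IsReducible {B : Type*} [NormedAddCommGroup B] [NormedSpace ℝ B]
    (L : ∀ x : M, Submodule ℝ (GenTangentSpace E x)) [ChartedSpace B (LeafSpace L)] : Prop where
  regular : ∃ r : ℕ, ∀ x, Module.finrank ℝ (charDistribution L x) = r
  submersion : Manifold.IsSubmersion 𝓘(ℝ, E) 𝓘(ℝ, B) ∞ (leafProj L)
  ker_eq : ∀ x (v : TangentSpace 𝓘(ℝ, E) x),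
    mfderiv 𝓘(ℝ, E) 𝓘(ℝ, B) (leafProj L) x v = 0 ↔ v ∈ charDistribution L x

end Basic

section Smooth

variable {E : Type*} [NormedAddCommGroup E] [NormedSpace ℝ E]
  {M : Type*} [TopologicalSpace M] [ChartedSpace E M] [IsManifold 𝓘(ℝ, E) ∞ M]

/-- Smoothness of a vector field on a set. -/
def SmoothVectorFieldOn (X : ∀ x : M, TangentSpace 𝓘(ℝ, E) x) (U : Set M) : Prop :=
  ContMDiffOn 𝓘(ℝ, E) (𝓘(ℝ, E).prod 𝓘(ℝ, E)) ∞
    (fun x => (TotalSpace.mk' E x (X x) : TangentBundle 𝓘(ℝ, E) M)) U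

/-- Smoothness of a 1-form on a set, as a section of the cotangent bundle `Hom(TM, ℝ)`. -/
def SmoothOneFormOn (α : ∀ x : M, TangentSpace 𝓘(ℝ, E) x →L[ℝ] ℝ) (U : Set M) : Prop :=
  ContMDiffOn 𝓘(ℝ, E) (𝓘(ℝ, E).prod 𝓘(ℝ, E →L[ℝ] ℝ)) ∞
    (fun x => TotalSpace.mk' (E →L[ℝ] ℝ)
      (E := fun y : M => TangentSpace 𝓘(ℝ, E) y →L[ℝ] Bundle.Trivial M ℝ y) x (α x)) U

/-- `X + α` is a global smooth section of `L`. -/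
structure IsSection (L : ∀ x : M, Submodule ℝ (GenTangentSpace E x))
    (X : ∀ x : M, TangentSpace 𝓘(ℝ, E) x)
    (α : ∀ x : M, TangentSpace 𝓘(ℝ, E) x →L[ℝ] ℝ) : Prop where
  smooth_fst : SmoothVectorFieldOn X Set.univ
  smooth_snd : SmoothOneFormOn α Set.univ
  mem : ∀ x, (X x, α x) ∈ L x

/-- `L` is a smooth vector subbundle of `TM ⊕ T^*M`: it has smooth local frames. -/
def IsSubbundle (L : ∀ x : M, Submodule ℝ (GenTangentSpace E x)) : Prop :=
  ∀ x₀ : M, ∃ U ∈ 𝓝 x₀, ∃ (k : ℕ)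
    (X : Fin k → ∀ x : M, TangentSpace 𝓘(ℝ, E) x)
    (α : Fin k → ∀ x : M, TangentSpace 𝓘(ℝ, E) x →L[ℝ] ℝ),
    (∀ i, SmoothVectorFieldOn (X i) U) ∧ (∀ i, SmoothOneFormOn (α i) U) ∧
    ∀ x ∈ U, LinearIndependent ℝ (fun i => ((X i x, α i x) : GenTangentSpace E x)) ∧
      Submodule.span ℝ (Set.range fun i => ((X i x, α i x) : GenTangentSpace E x)) = L x

/-- The smooth sections of `L` are closed under the Courant bracket: at every point `x`, the
Courant bracket of two sections, i.e. the pair of `[X, Y]_x` and the covector `γ` with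
`γ(W_x) = (L_X β - L_Y α + d(α(Y) - β(X)) / 2)(W)(x)` for all vector fields `W`,
lies in `L_x`. -/
def IsIntegrable (L : ∀ x : M, Submodule ℝ (GenTangentSpace E x)) : Prop :=
  ∀ X α Y β, IsSection L X α → IsSection L Y β → ∀ x : M,
    ∃ γ : TangentSpace 𝓘(ℝ, E) x →L[ℝ] ℝ,
      (∀ W : ∀ y : M, TangentSpace 𝓘(ℝ, E) y, SmoothVectorFieldOn W Set.univ →
        γ (W x) = courantForm X α Y β W x) ∧
      (VectorField.mlieBracket 𝓘(ℝ, E) X Y x, γ) ∈ L x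

/-- Dirac structures: integrable maximally isotropic subbundles of `TM ⊕ T^*M`. -/
structure IsDirac (L : ∀ x : M, Submodule ℝ (GenTangentSpace E x)) : Prop where
  subbundle : IsSubbundle L
  maximal_isotropic : ∀ x, Maximal IsIsotropic (L x)
  integrable : IsIntegrable L

/-- `X` is a Hamiltonian vector field of `f`: `X` is smooth and `X + df` is a section of `L`. -/
def IsHamiltonian (L : ∀ x : M, Submodule ℝ (GenTangentSpace E x))
    (X : ∀ x : M, TangentSpace 𝓘(ℝ, E) x) (f : M → ℝ) : Prop :=
  SmoothVectorFieldOn X Set.univ ∧ ∀ x, (X x, dAt E f x) ∈ L x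

end Smooth

section Poisson

/-- A Poisson structure on the manifold `Q`: a Lie bracket on `C^∞(Q)` which is a derivation in each
argument. -/
@[ext]
structure PoissonStructure (B : Type*) [NormedAddCommGroup B] [NormedSpace ℝ B]
    (Q : Type*) [TopologicalSpace Q] [ChartedSpace B Q] where
  bracket : C^∞⟮𝓘(ℝ, B), Q; ℝ⟯ →ₗ[ℝ] C^∞⟮𝓘(ℝ, B), Q; ℝ⟯ →ₗ[ℝ] C^∞⟮𝓘(ℝ, B), Q; ℝ⟯
  skew : ∀ f g, bracket f g = -bracket g f
  leibniz : ∀ f g h, bracket f (g * h) = bracket f g * h + g * bracket f h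
  jacobi : ∀ f g h,
    bracket f (bracket g h) + bracket g (bracket h f) + bracket h (bracket f g) = 0

variable {B : Type*} [NormedAddCommGroup B] [NormedSpace ℝ B]
  {Q : Type*} [TopologicalSpace Q] [ChartedSpace B Q]

theorem mdiffAt (f : C^∞⟮𝓘(ℝ, B), Q; ℝ⟯) (y : Q) :
    MDifferentiableAt 𝓘(ℝ, B) 𝓘(ℝ, ℝ) f y :=
  f.contMDiff.mdifferentiableAt (by simp)

/-- The graph `L_π = {π^♯ β + β}` of the Poisson bivector `π`, where `π(df, dg) = {f, g}`:
at `y` it consists of the pairs `(v, d_y f)` with `v = π^♯(d_y f)`, i.e. with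
`d_y g (v) = {f, g}(y)` for all `g`. -/
def PoissonStructure.graph (P : PoissonStructure B Q) (y : Q) :
    Submodule ℝ (GenTangentSpace B y) where
  carrier := {u | ∃ f : C^∞⟮𝓘(ℝ, B), Q; ℝ⟯, dAt B f y = u.2 ∧
    ∀ g : C^∞⟮𝓘(ℝ, B), Q; ℝ⟯, dAt B g y u.1 = P.bracket f g y}
  add_mem' := by
    rintro u w ⟨f, hf, hfg⟩ ⟨f', hf', hfg'⟩
    refine ⟨f + f', ?_, fun g => ?_⟩
    · rw [Prod.snd_add, ← hf, ← hf']
      exact mfderiv_add (mdiffAt f y) (mdiffAt f' y)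
    · rw [Prod.fst_add, map_add, hfg, hfg', map_add]
      rfl
  zero_mem' := by
    refine ⟨0, ?_, fun g => ?_⟩
    · exact mfderiv_const (I := 𝓘(ℝ, B)) (I' := 𝓘(ℝ, ℝ)) (c := (0 : ℝ)) (x := y)
    · rw [map_zero]
      exact map_zero _
  smul_mem' := by
    rintro c u ⟨f, hf, hfg⟩
    refine ⟨c • f, ?_, fun g => ?_⟩
    · rw [Prod.smul_snd, ← hf]
      exact const_smul_mfderiv (mdiffAt f y) c
    · rw [Prod.smul_fst, map_smul, hfg, map_smul]
      rfl

variable {E : Type*} [NormedAddCommGroup E] [NormedSpace ℝ E]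
  {M : Type*} [TopologicalSpace M] [ChartedSpace E M] [IsManifold 𝓘(ℝ, E) ∞ M]

/-- `P` is the Poisson structure induced by `L` on the leaf space: for all smooth `f`, `g` on
`M / 𝓕_L` the function `f ∘ p` is `L`-admissible, and
`{f, g} ∘ p = {f ∘ p, g ∘ p}_L = X_{f ∘ p}(g ∘ p)` for every vector field `X_{f ∘ p}`
such that `X_{f ∘ p} + d(f ∘ p)` is a section of `L`. -/
def IsReducedPoisson (L : ∀ x : M, Submodule ℝ (GenTangentSpace E x))
    [ChartedSpace B (LeafSpace L)] (P : PoissonStructure B (LeafSpace L)) : Prop :=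
  ∀ f : C^∞⟮𝓘(ℝ, B), LeafSpace L; ℝ⟯,
    (∃ X, IsHamiltonian L X (f ∘ leafProj L)) ∧
    ∀ X, IsHamiltonian L X (f ∘ leafProj L) → ∀ (g : C^∞⟮𝓘(ℝ, B), LeafSpace L; ℝ⟯) (x : M),
      P.bracket f g (leafProj L x) = dAt E (g ∘ leafProj L) x (X x)

end Poisson

section Maps

variable {E : Type*} [NormedAddCommGroup E] [NormedSpace ℝ E]
  {M : Type*} [TopologicalSpace M] [ChartedSpace E M]
  {F : Type*} [NormedAddCommGroup F] [NormedSpace ℝ F]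
  {N : Type*} [TopologicalSpace N] [ChartedSpace F N]

/-- The backward image
`𝓑_φ(K) = {X + φ^*α : φ_* X + α ∈ K_{φ(x)}}`. -/
def backwardImage (φ : M → N) (K : ∀ y : N, Submodule ℝ (GenTangentSpace F y)) (x : M) :
    Submodule ℝ (GenTangentSpace E x) where
  carrier := {u | ∃ α : TangentSpace 𝓘(ℝ, F) (φ x) →L[ℝ] ℝ,
    u.2 = α.comp (mfderiv 𝓘(ℝ, E) 𝓘(ℝ, F) φ x) ∧
      (mfderiv 𝓘(ℝ, E) 𝓘(ℝ, F) φ x u.1, α) ∈ K (φ x)}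
  add_mem' := by
    rintro u w ⟨α, hα, hu⟩ ⟨β, hβ, hw⟩
    refine ⟨α + β, ?_, ?_⟩
    · rw [Prod.snd_add, hα, hβ, ContinuousLinearMap.add_comp]
    · rw [Prod.fst_add, map_add]
      exact (K (φ x)).add_mem hu hw
  zero_mem' := by
    refine ⟨0, ?_, ?_⟩
    · rw [ContinuousLinearMap.zero_comp]
      rfl
    · rw [Prod.fst_zero, map_zero]
      exact (K (φ x)).zero_mem
  smul_mem' := by
    rintro c u ⟨α, hα, hu⟩
    refine ⟨c • α, ?_, ?_⟩
    · rw [Prod.smul_snd, hα, ContinuousLinearMap.smul_comp]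
    · rw [Prod.smul_fst, map_smul]
      exact (K (φ x)).smul_mem c hu

/-- `φ : (M, L) → (N, K)` is a b-Dirac map: `φ` is smooth and `L = 𝓑_φ(K)`. -/
structure IsBDirac (L : ∀ x : M, Submodule ℝ (GenTangentSpace E x))
    (K : ∀ y : N, Submodule ℝ (GenTangentSpace F y)) (φ : M → N) : Prop where
  smooth : ContMDiff 𝓘(ℝ, E) 𝓘(ℝ, F) ∞ φ
  eq_backwardImage : ∀ x, L x = backwardImage φ K x

/-- `φ` maps every leaf of the characteristic foliation of `L` into a leaf of that of `K`. -/
def PreservesLeaves (L : ∀ x : M, Submodule ℝ (GenTangentSpace E x))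
    (K : ∀ y : N, Submodule ℝ (GenTangentSpace F y)) (φ : M → N) : Prop :=
  ∀ x x' : M, leafSetoid L x x' → leafSetoid K (φ x) (φ x')

/-- The map of leaf spaces induced by a map that preserves the characteristic foliations. -/
def inducedMap (L : ∀ x : M, Submodule ℝ (GenTangentSpace E x))
    (K : ∀ y : N, Submodule ℝ (GenTangentSpace F y)) (φ : M → N) (h : PreservesLeaves L K φ) :
    LeafSpace L → LeafSpace K :=
  Quotient.map φ h

end Maps

end

end DiracGeometry

/-! Write `p`, `q` for the projections of `M`, `N` onto their leaf spaces. Everything rests on one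
equivalence, `IsReducedPoisson.mem_graph_iff`: `(p_* v, β)` lies in the graph of the reduced Poisson
structure iff `(v, p^*β)` lies in `L`. Since `L` is isotropic and `D_L = ker p_*`, covector parts of
`L` are pullbacks along `p`, so `L` is the backward image of that graph
(`IsReducedPoisson.mem_iff`). Membership of `(p_* v, β)` in the graph on `M / 𝓕_L` thus translates
into `L = 𝓑_φ(K)`, then into the graph on `N / 𝓕_K`; the chain rule for `q ∘ φ = φ̄ ∘ p` and
surjectivity of `p_*` match the two sides.

The reduced bracket needs Hamiltonian vector fields. The differential of `f ∘ p` kills `D_L`; by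
maximal isotropy the covectors killing `D_L` are exactly the covector parts of `L`, and constant
rank makes the corresponding vectors locally smooth (`exists_local_vectorField`). A partition of
unity glues them. Integrability gives `[X_f, X_g] + d(X_f g) ∈ L` (`IsHamiltonian.mlieBracket_mem`).
Hence `d(X_f g)` kills `D_L`, so `X_f g` descends to the leaf space; the same relation yields the
Jacobi identity. -/

namespace DiracGeometry

/-! ### Differentials, smooth 1-forms, and extension of pointwise data. -/

section Calculus

variable {E : Type*} [NormedAddCommGroup E] [NormedSpace ℝ E]
  {M : Type*} [TopologicalSpace M] [ChartedSpace E M]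

theorem dAt_congr {f g : M → ℝ} {x : M} (h : f =ᶠ[𝓝 x] g) : dAt E f x = dAt E g x :=
  h.mfderiv_eq

theorem dAt_comp_apply {F : Type*} [NormedAddCommGroup F] [NormedSpace ℝ F]
    {N : Type*} [TopologicalSpace N] [ChartedSpace F N] {f : N → ℝ} {φ : M → N} {x : M}
    (hf : MDifferentiableAt 𝓘(ℝ, F) 𝓘(ℝ, ℝ) f (φ x))
    (hφ : MDifferentiableAt 𝓘(ℝ, E) 𝓘(ℝ, F) φ x) :
    dAt E (f ∘ φ) x = (dAt F f (φ x)).comp (mfderiv 𝓘(ℝ, E) 𝓘(ℝ, F) φ x) :=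
  mfderiv_comp x hf hφ

theorem dAt_model (f : E → ℝ) (x : E) : dAt E f x = fderiv ℝ f x :=
  mfderiv_eq_fderiv

theorem dAt_add {f g : M → ℝ} {x : M} (hf : MDifferentiableAt 𝓘(ℝ, E) 𝓘(ℝ, ℝ) f x)
    (hg : MDifferentiableAt 𝓘(ℝ, E) 𝓘(ℝ, ℝ) g x) : dAt E (f + g) x = dAt E f x + dAt E g x :=
  mfderiv_add hf hg

theorem dAt_const_smul {f : M → ℝ} {x : M} (hf : MDifferentiableAt 𝓘(ℝ, E) 𝓘(ℝ, ℝ) f x)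
    (c : ℝ) : dAt E (c • f) x = c • dAt E f x :=
  const_smul_mfderiv hf c

theorem dAt_mul_apply {f g : M → ℝ} {x : M} (hf : MDifferentiableAt 𝓘(ℝ, E) 𝓘(ℝ, ℝ) f x)
    (hg : MDifferentiableAt 𝓘(ℝ, E) 𝓘(ℝ, ℝ) g x) (v : TangentSpace 𝓘(ℝ, E) x) :
    dAt E (f * g) x v = dAt E f x v * g x + f x * dAt E g x v := by
  have := congrArg (fun A : TangentSpace 𝓘(ℝ, E) x →L[ℝ] ℝ => A v)
    (hf.hasMFDerivAt.mul hg.hasMFDerivAt).mfderiv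
  refine this.trans ?_
  change f x * dAt E g x v + g x * dAt E f x v = _
  ring

variable [IsManifold 𝓘(ℝ, E) ∞ M]

theorem smoothOneFormOn_dAt {f : M → ℝ} (hf : ContMDiff 𝓘(ℝ, E) 𝓘(ℝ, ℝ) ∞ f) :
    SmoothOneFormOn (dAt E f) (Set.univ : Set M) := by
  intro x _
  refine ContMDiffAt.contMDiffWithinAt ?_
  rw [contMDiffAt_hom_bundle]
  refine ⟨contMDiffAt_id, ?_⟩
  refine ((hf x).mfderiv_const (m := ∞) (by simp)).congr_of_eventuallyEq ?_
  refine Filter.Eventually.of_forall fun y => ?_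
  ext v
  simp [inTangentCoordinates, ContinuousLinearMap.inCoordinates, dAt]
  rfl

theorem contMDiffOn_oneForm_apply {U : Set M} {α : ∀ x : M, TangentSpace 𝓘(ℝ, E) x →L[ℝ] ℝ}
    {X : ∀ x : M, TangentSpace 𝓘(ℝ, E) x} (hα : SmoothOneFormOn α U)
    (hX : SmoothVectorFieldOn X U) :
    ContMDiffOn 𝓘(ℝ, E) 𝓘(ℝ, ℝ) ∞ (fun x => α x (X x)) U := by
  have := ContMDiffOn.clm_bundle_apply (F₁ := E) (F₂ := ℝ)
    (E₁ := fun x : M => TangentSpace 𝓘(ℝ, E) x) (E₂ := Bundle.Trivial M ℝ) hα hX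
  intro x hx
  exact ((contMDiffWithinAt_totalSpace).1 (this x hx)).2

theorem contMDiff_dAt_apply {f : M → ℝ} (hf : ContMDiff 𝓘(ℝ, E) 𝓘(ℝ, ℝ) ∞ f)
    {X : ∀ x : M, TangentSpace 𝓘(ℝ, E) x} (hX : SmoothVectorFieldOn X Set.univ) :
    ContMDiff 𝓘(ℝ, E) 𝓘(ℝ, ℝ) ∞ (fun x => dAt E f x (X x)) :=
  contMDiffOn_univ.1 (contMDiffOn_oneForm_apply (smoothOneFormOn_dAt hf) hX)

/-- Prescribing the value at a single point is a convex condition, so a partition of unity glues a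
local extension near `x` to the zero field elsewhere. This lets covectors be tested on global
fields, as `IsIntegrable` requires. -/
theorem exists_smoothVectorField_apply_eq [FiniteDimensional ℝ E] [T2Space M]
    [SecondCountableTopology M] {x : M} (v : TangentSpace 𝓘(ℝ, E) x) :
    ∃ W : ∀ y : M, TangentSpace 𝓘(ℝ, E) y, SmoothVectorFieldOn W Set.univ ∧ W x = v := by
  have : LocallyCompactSpace M := ChartedSpace.locallyCompactSpace E M
  let t : ∀ y : M, Set (TangentSpace 𝓘(ℝ, E) y) :=
    fun y => {w | y = x → w = FiberBundle.extend E v y}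
  have ht : ∀ y, Convex ℝ (t y) := by
    intro y a ha b hb p q _ _ hpq hy
    rw [ha hy, hb hy, ← add_smul, hpq, one_smul]
  obtain ⟨s, hs⟩ := exists_contMDiffSection_forall_mem_convex_of_local 𝓘(ℝ, E)
    (F_fiber := E) (n := ⊤) (fun y : M => TangentSpace 𝓘(ℝ, E) y) t ht (by
      intro y
      by_cases hy : y = x
      · subst hy
        obtain ⟨U, hU, h⟩ := FiberBundle.exists_contMDiffOn_extend (k := ∞) 𝓘(ℝ, E) E v
        exact ⟨U, hU, _, h, fun _ _ _ => rfl⟩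
      · exact ⟨{x}ᶜ, isOpen_compl_singleton.mem_nhds hy, fun z => 0,
          (contMDiff_zeroSection ℝ (fun y : M => TangentSpace 𝓘(ℝ, E) y)).contMDiffOn,
          fun z hz h => (hz h).elim⟩)
  exact ⟨s, s.contMDiff.contMDiffOn, by simpa using hs x rfl⟩

/-- Take a linear functional in the chart at `x` and cut it off with a bump function, which equals 1
near `x`. -/
theorem exists_smooth_dAt_eq [FiniteDimensional ℝ E] [T2Space M] {x : M}
    (β : TangentSpace 𝓘(ℝ, E) x →L[ℝ] ℝ) :
    ∃ f : C^∞⟮𝓘(ℝ, E), M; ℝ⟯, dAt E f x = β := by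
  let ρ : SmoothBumpFunction 𝓘(ℝ, E) x := Classical.arbitrary _
  let e := extChartAt 𝓘(ℝ, E) x
  have hx : x ∈ e.source := mem_extChartAt_source x
  have he : MDifferentiableAt 𝓘(ℝ, E) 𝓘(ℝ, E) e x :=
    mdifferentiableAt_extChartAt (mem_chart_source E x)
  obtain ⟨A, hA⟩ := isInvertible_mfderiv_extChartAt (I := 𝓘(ℝ, E)) hx
  let β' : E →L[ℝ] ℝ := β.comp A.symm.toContinuousLinearMap
  have hs : ContMDiff 𝓘(ℝ, E) 𝓘(ℝ, ℝ) ∞ (fun y => ρ y • (β' (e y))) := by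
    refine ρ.contMDiff_smul ?_
    exact β'.contMDiff.comp_contMDiffOn contMDiffOn_extChartAt
  refine ⟨⟨_, hs⟩, ?_⟩
  have h1 : (fun y => ρ y • (β' (e y))) =ᶠ[𝓝 x] β' ∘ e := by
    filter_upwards [ρ.eventuallyEq_one] with y hy
    simp [hy]
  refine (dAt_congr h1).trans ?_
  rw [dAt_comp_apply (β'.mdifferentiableAt) he, dAt_model, β'.fderiv]
  ext v
  change β (A.symm (mfderiv 𝓘(ℝ, E) 𝓘(ℝ, E) e x v)) = β v
  rw [← hA]
  congr 1
  exact A.symm_apply_apply v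

end Calculus

/-! ### The Lie bracket as a commutator of derivations. -/

section LieBracket

variable {E : Type*} [NormedAddCommGroup E] [NormedSpace ℝ E]
  {M : Type*} [TopologicalSpace M] [ChartedSpace E M] [IsManifold 𝓘(ℝ, E) ∞ M]

/-- The second-order terms cancel by symmetry of the second derivative. -/
theorem fderiv_lieBracket_apply {g : E → ℝ} {V W : E → E} {y : E} (hg : ContDiffAt ℝ 2 g y)
    (hV : DifferentiableAt ℝ V y) (hW : DifferentiableAt ℝ W y) :
    fderiv ℝ g y (VectorField.lieBracket ℝ V W y)
      = fderiv ℝ (fun z => fderiv ℝ g z (W z)) y (V y)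
        - fderiv ℝ (fun z => fderiv ℝ g z (V z)) y (W y) := by
  have hg' : DifferentiableAt ℝ (fderiv ℝ g) y :=
    (hg.fderiv_right (m := 1) (by norm_num)).differentiableAt (by norm_num)
  have hsymm : IsSymmSndFDerivAt ℝ g y := hg.isSymmSndFDerivAt (by simp)
  rw [fderiv_clm_apply hg' hW, fderiv_clm_apply hg' hV]
  simp only [_root_.add_apply, ContinuousLinearMap.comp_apply,
    ContinuousLinearMap.flip_apply, VectorField.lieBracket, map_sub]
  rw [hsymm.eq (V y) (W y)]
  ring

/-- The representative of a vector field in the chart at `x`. -/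
noncomputable def chartVectorField (x : M) (V : ∀ y : M, TangentSpace 𝓘(ℝ, E) y) (z : E) : E :=
  VectorField.mpullback 𝓘(ℝ, E) 𝓘(ℝ, E) (extChartAt 𝓘(ℝ, E) x).symm V z

omit [IsManifold 𝓘(ℝ, E) ∞ M] in
theorem mlieBracket_eq_chart (V W : ∀ y : M, TangentSpace 𝓘(ℝ, E) y) (x : M) :
    VectorField.mlieBracket 𝓘(ℝ, E) V W x
      = (mfderiv 𝓘(ℝ, E) 𝓘(ℝ, E) (extChartAt 𝓘(ℝ, E) x) x).inverse
        (VectorField.lieBracket (E := E) ℝ (chartVectorField x V) (chartVectorField x W)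
          (extChartAt 𝓘(ℝ, E) x x)) := by
  rw [← VectorField.mlieBracketWithin_univ, VectorField.mlieBracketWithin_apply]
  simp only [ModelWithCorners.range_eq_univ, Set.preimage_univ, Set.inter_univ,
    VectorField.mpullbackWithin_univ]
  exact congrArg (fun Z : E => (mfderiv 𝓘(ℝ, E) 𝓘(ℝ, E) (extChartAt 𝓘(ℝ, E) x) x).inverse Z)
    (congrFun (VectorField.lieBracketWithin_univ (V := chartVectorField x V)
      (W := chartVectorField x W)) _)

theorem differentiableAt_chartVectorField [CompleteSpace E]
    {V : ∀ y : M, TangentSpace 𝓘(ℝ, E) y} (hV : SmoothVectorFieldOn V Set.univ) (x : M) :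
    DifferentiableAt ℝ (chartVectorField x V) (extChartAt 𝓘(ℝ, E) x x) := by
  have h := VectorField.contMDiffWithinAt_mpullbackWithin_extChartAt_symm (n := ∞) (m := 1)
    (hV.of_le (by simp) x (Set.mem_univ x)) uniqueMDiffOn_univ (Set.mem_univ x)
    (by norm_num; exact ENat.LEInfty.out)
  simp only [ModelWithCorners.range_eq_univ, Set.preimage_univ, Set.inter_univ,
    VectorField.mpullbackWithin_univ] at h
  have h2 := h.contMDiffAt (extChartAt_target_mem_nhds x)
  have h3 := ((contMDiffAt_totalSpace).1 h2).2
  have h4 := (contMDiffAt_iff_contDiffAt.1 h3).differentiableAt (by norm_num)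
  refine h4.congr_of_eventuallyEq ?_
  refine Filter.Eventually.of_forall fun z => ?_
  simp [chartVectorField]
  rfl

theorem fderiv_chart_apply {g : M → ℝ} (hg : ContMDiff 𝓘(ℝ, E) 𝓘(ℝ, ℝ) ∞ g)
    (V : ∀ y : M, TangentSpace 𝓘(ℝ, E) y) (x : M) {z : E}
    (hz : z ∈ (extChartAt 𝓘(ℝ, E) x).target) :
    fderiv ℝ (g ∘ (extChartAt 𝓘(ℝ, E) x).symm) z (chartVectorField x V z)
      = dAt E g ((extChartAt 𝓘(ℝ, E) x).symm z) (V ((extChartAt 𝓘(ℝ, E) x).symm z)) := by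
  have hd : MDifferentiableAt 𝓘(ℝ, E) 𝓘(ℝ, E) (extChartAt 𝓘(ℝ, E) x).symm z :=
    (contMDiffOn_extChartAt_symm (n := ∞) x).contMDiffAt
      ((isOpen_extChartAt_target x).mem_nhds hz) |>.mdifferentiableAt (by simp)
  have hi := isInvertible_mfderivWithin_extChartAt_symm (I := 𝓘(ℝ, E)) hz
  rw [ModelWithCorners.range_eq_univ, mfderivWithin_univ] at hi
  rw [← dAt_model, dAt_comp_apply (hg.mdifferentiableAt (by simp)) hd]
  change dAt E g _ (mfderiv 𝓘(ℝ, E) 𝓘(ℝ, E) (extChartAt 𝓘(ℝ, E) x).symm z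
    ((mfderiv 𝓘(ℝ, E) 𝓘(ℝ, E) (extChartAt 𝓘(ℝ, E) x).symm z).inverse _)) = _
  rw [hi.self_apply_inverse]

/-- The Lie bracket of vector fields is the commutator of the derivations that they define. -/
theorem dAt_mlieBracket [CompleteSpace E] {g : M → ℝ} (hg : ContMDiff 𝓘(ℝ, E) 𝓘(ℝ, ℝ) ∞ g)
    {X Y : ∀ y : M, TangentSpace 𝓘(ℝ, E) y} (hX : SmoothVectorFieldOn X Set.univ)
    (hY : SmoothVectorFieldOn Y Set.univ) (x : M) :
    dAt E g x (VectorField.mlieBracket 𝓘(ℝ, E) X Y x)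
      = dAt E (fun y => dAt E g y (Y y)) x (X x) - dAt E (fun y => dAt E g y (X y)) x (Y x) := by
  set e := extChartAt 𝓘(ℝ, E) x with he
  have hex : e x ∈ e.target := mem_extChartAt_target x
  have hxe : e.symm (e x) = x := extChartAt_to_inv x
  have key : ∀ (h : M → ℝ), ContMDiff 𝓘(ℝ, E) 𝓘(ℝ, ℝ) ∞ h →
      ∀ V : ∀ y : M, TangentSpace 𝓘(ℝ, E) y,
      fderiv ℝ (h ∘ e.symm) (e x) (chartVectorField x V (e x)) = dAt E h x (V x) := by
    intro h hh V
    rw [fderiv_chart_apply hh V x hex, ← he, hxe]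
  -- The inner derivative is identified with `W g` on the chart target only; this is a neighbourhood
  -- of `e x`, so the outer derivative agrees.
  have key2 : ∀ V W : ∀ y : M, TangentSpace 𝓘(ℝ, E) y, SmoothVectorFieldOn W Set.univ →
      fderiv ℝ (fun z => fderiv ℝ (g ∘ e.symm) z (chartVectorField x W z)) (e x)
        (chartVectorField x V (e x)) = dAt E (fun y => dAt E g y (W y)) x (V x) := by
    intro V W hW
    rw [← key _ (contMDiff_dAt_apply hg hW) V]
    congr 1
    refine Filter.EventuallyEq.fderiv_eq ?_
    filter_upwards [extChartAt_target_mem_nhds x] with z hz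
    exact fderiv_chart_apply hg W x hz
  have hg2 : ContDiffAt ℝ 2 (g ∘ e.symm) (e x) := by
    rw [← contMDiffAt_iff_contDiffAt]
    refine ContMDiffAt.comp _ (hg.contMDiffAt.of_le ENat.LEInfty.out) ?_
    exact (contMDiffOn_extChartAt_symm x).contMDiffAt (extChartAt_target_mem_nhds x)
  have hdg : MDifferentiableAt 𝓘(ℝ, E) 𝓘(ℝ, ℝ) (g ∘ e.symm) (e x) :=
    (hg2.differentiableAt (by norm_num)).mdifferentiableAt
  have hge : g =ᶠ[𝓝 x] (g ∘ e.symm) ∘ e := by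
    filter_upwards [extChartAt_source_mem_nhds (I := 𝓘(ℝ, E)) x] with y hy
    exact congrArg g ((extChartAt 𝓘(ℝ, E) x).left_inv hy).symm
  have hinv := isInvertible_mfderiv_extChartAt (I := 𝓘(ℝ, E)) (mem_extChartAt_source x)
  rw [← key2 X Y hY, ← key2 Y X hX,
    ← fderiv_lieBracket_apply hg2 (differentiableAt_chartVectorField hX x)
      (differentiableAt_chartVectorField hY x),
    mlieBracket_eq_chart, dAt_congr hge,
    dAt_comp_apply hdg (mdifferentiableAt_extChartAt (mem_chart_source E x)), dAt_model]
  change fderiv ℝ (g ∘ e.symm) (e x) (mfderiv 𝓘(ℝ, E) 𝓘(ℝ, E) (extChartAt 𝓘(ℝ, E) x) x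
    ((mfderiv 𝓘(ℝ, E) 𝓘(ℝ, E) (extChartAt 𝓘(ℝ, E) x) x).inverse _)) = _
  exact congrArg (fderiv ℝ (g ∘ e.symm) (e x)) (hinv.self_apply_inverse _)

end LieBracket

/-! ### Local sections of submersions and descent of smoothness. -/

section Submersion

variable {E : Type*} [NormedAddCommGroup E] [NormedSpace ℝ E]
  {M : Type*} [TopologicalSpace M] [ChartedSpace E M]
  {B : Type*} [NormedAddCommGroup B] [NormedSpace ℝ B]
  {Q : Type*} [TopologicalSpace Q] [ChartedSpace B Q]

theorem exists_local_section {p : M → Q} {x : M}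
    (hp : Manifold.IsSubmersionAt 𝓘(ℝ, E) 𝓘(ℝ, B) ∞ p x) :
    ∃ s : Q → M, s (p x) = x ∧ ContMDiffAt 𝓘(ℝ, B) 𝓘(ℝ, E) ∞ s (p x) ∧
      ∀ᶠ y in 𝓝 (p x), p (s y) = y := by
  obtain ⟨G, _, _, h⟩ := hp
  let a := h.domChart
  let b := h.codChart
  let ε := h.equiv
  have hxa : x ∈ a.source := h.mem_domChart_source
  have hxb : p x ∈ b.source := h.mem_codChart_source
  have hw : ∀ u ∈ a.target, b (p (a.symm u)) = (ε u).1 := fun u hu =>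
    h.writtenInCharts (by simpa using hu)
  -- In submersion charts `p` is the projection `(z, w) ↦ z`; the section freezes `w` at its value
  -- at `x`.
  let ι : B → E := fun z => ε.symm (z, (ε (a x)).2)
  have hι0 : ι (b (p x)) = a x := by
    have h1 := hw (a x) (a.map_source hxa)
    rw [a.left_inv hxa] at h1
    simp only [ι]
    rw [h1, Prod.mk.eta, ε.symm_apply_apply]
  have hι : ContDiff ℝ ∞ ι := by
    exact ε.symm.contDiff.comp (contDiff_id.prodMk contDiff_const)
  have hb : ContMDiffAt 𝓘(ℝ, B) 𝓘(ℝ, B) ∞ b (p x) :=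
    contMDiffAt_of_mem_maximalAtlas h.codChart_mem_maximalAtlas hxb
  have hιb : ContMDiffAt 𝓘(ℝ, B) 𝓘(ℝ, E) ∞ (ι ∘ b) (p x) :=
    hι.contMDiff.contMDiffAt.comp _ hb
  have htgt : a.target ∈ 𝓝 ((ι ∘ b) (p x)) := by
    rw [Function.comp_apply, hι0]
    exact a.open_target.mem_nhds (a.map_source hxa)
  refine ⟨a.symm ∘ ι ∘ b, ?_, ?_, ?_⟩
  · simp only [Function.comp_apply, hι0, a.left_inv hxa]
  · exact ((contMDiffOn_symm_of_mem_maximalAtlas h.domChart_mem_maximalAtlas).contMDiffAt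
      htgt).comp _ hιb
  · filter_upwards [hιb.continuousAt htgt, b.open_source.mem_nhds hxb] with y hy hyb
    have h2 := hw _ hy
    refine b.injOn (h.mapsto_domChart_source_codChart_source (a.map_target hy)) hyb ?_
    refine h2.trans ?_
    simp [ι]

theorem mfderiv_surjective_of_isSubmersionAt {p : M → Q} {x : M}
    (hp : Manifold.IsSubmersionAt 𝓘(ℝ, E) 𝓘(ℝ, B) ∞ p x) :
    Function.Surjective (mfderiv 𝓘(ℝ, E) 𝓘(ℝ, B) p x) := by
  obtain ⟨s, hsx, hs, hps⟩ := exists_local_section hp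
  have hpx : MDifferentiableAt 𝓘(ℝ, E) 𝓘(ℝ, B) p (s (p x)) := by
    rw [hsx]
    exact hp.contMDiffAt.mdifferentiableAt (by simp)
  have h1 := mfderiv_comp (p x) hpx (hs.mdifferentiableAt (by simp))
  have h2 : p ∘ s =ᶠ[𝓝 (p x)] id := hps
  rw [h2.mfderiv_eq, mfderiv_id, hsx] at h1
  intro v
  exact ⟨mfderiv 𝓘(ℝ, B) 𝓘(ℝ, E) s (p x) v,
    (congrArg (fun A : TangentSpace 𝓘(ℝ, B) (p x) →L[ℝ] TangentSpace 𝓘(ℝ, B) (p x) => A v)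
      h1).symm⟩

/-- Near `p x`, `g` equals `(g ∘ p) ∘ s` for a local section `s`. -/
theorem contMDiff_of_comp_submersion {F : Type*} [NormedAddCommGroup F] [NormedSpace ℝ F]
    {N : Type*} [TopologicalSpace N] [ChartedSpace F N] {p : M → Q}
    (hp : Manifold.IsSubmersion 𝓘(ℝ, E) 𝓘(ℝ, B) ∞ p) (hsurj : Function.Surjective p)
    {g : Q → N} (hg : ContMDiff 𝓘(ℝ, E) 𝓘(ℝ, F) ∞ (g ∘ p)) :
    ContMDiff 𝓘(ℝ, B) 𝓘(ℝ, F) ∞ g := by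
  intro y
  obtain ⟨x, rfl⟩ := hsurj y
  obtain ⟨s, -, hs, hps⟩ := exists_local_section (hp.isSubmersionAt x)
  refine ((hg (s (p x))).comp (p x) hs).congr_of_eventuallyEq ?_
  filter_upwards [hps] with z hz
  simp [hz]

end Submersion

/-! ### Functions constant along the leaves. -/

section LeafSpace

variable {E : Type*} [NormedAddCommGroup E] [NormedSpace ℝ E]
  {M : Type*} [TopologicalSpace M] [ChartedSpace E M]

theorem leafProj_surjective (L : ∀ x : M, Submodule ℝ (GenTangentSpace E x)) :
    Function.Surjective (leafProj L) :=
  Quotient.mk_surjective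

theorem mem_charDistribution {L : ∀ x : M, Submodule ℝ (GenTangentSpace E x)} {x : M}
    {v : TangentSpace 𝓘(ℝ, E) x} : v ∈ charDistribution L x ↔ (v, 0) ∈ L x :=
  Iff.rfl

/-- A smooth function whose differential vanishes on the characteristic distribution is constant
on the leaves. -/
theorem eq_of_leafSetoid {L : ∀ x : M, Submodule ℝ (GenTangentSpace E x)} {h : M → ℝ}
    (hh : ContMDiff 𝓘(ℝ, E) 𝓘(ℝ, ℝ) ∞ h)
    (hd : ∀ x, ∀ v ∈ charDistribution L x, dAt E h x v = 0) {x y : M} (hxy : leafSetoid L x y) :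
    h x = h y := by
  induction hxy with
  | rel x y hxy =>
    obtain ⟨γ, ⟨hγ, hγ'⟩, rfl, rfl⟩ := hxy
    have hdiff : ContMDiff 𝓘(ℝ, ℝ) 𝓘(ℝ, ℝ) ∞ (h ∘ γ) := hh.comp hγ
    refine is_const_of_deriv_eq_zero (hdiff.contDiff.differentiable (by simp)) (fun t => ?_) 0 1
    change fderiv ℝ (h ∘ γ) t 1 = 0
    rw [← dAt_model, dAt_comp_apply (hh.mdifferentiableAt (by simp))
      (hγ.mdifferentiableAt (by simp))]
    exact hd _ _ (hγ' t)
  | refl => rfl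
  | symm _ _ _ ih => exact ih.symm
  | trans _ _ _ _ _ ih₁ ih₂ => exact ih₁.trans ih₂

end LeafSpace

/-! ### Linear algebra of maximal isotropic subspaces, and Cramer's rule. -/

section LinearAlgebra

variable {E : Type*} [NormedAddCommGroup E] [NormedSpace ℝ E]
  {M : Type*} [TopologicalSpace M] [ChartedSpace E M]

theorem IsIsotropic.apply_add_apply {x : M} {S : Submodule ℝ (GenTangentSpace E x)}
    (hS : IsIsotropic S) {u w : GenTangentSpace E x} (hu : u ∈ S) (hw : w ∈ S) :
    w.2 u.1 + u.2 w.1 = 0 := by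
  have := hS u hu w hw
  simp only [symmPairing] at this
  linarith

theorem IsIsotropic.apply_eq_zero {L : ∀ x : M, Submodule ℝ (GenTangentSpace E x)} {x : M}
    (hL : IsIsotropic (L x)) {v : TangentSpace 𝓘(ℝ, E) x} (hv : v ∈ charDistribution L x)
    {u : GenTangentSpace E x} (hu : u ∈ L x) : u.2 v = 0 := by
  simpa using hL.apply_add_apply hv hu

/-- The projection of `L_x` to `T_x^* M`. -/
noncomputable def covectorRange (L : ∀ x : M, Submodule ℝ (GenTangentSpace E x)) (x : M) :
    Subspace ℝ (Module.Dual ℝ (TangentSpace 𝓘(ℝ, E) x)) :=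
  (L x).map ((ContinuousLinearMap.coeLM ℝ).comp
    (LinearMap.snd ℝ (TangentSpace 𝓘(ℝ, E) x) (TangentSpace 𝓘(ℝ, E) x →L[ℝ] ℝ)))

/-- If all covector parts of `L_x` kill `v`, adjoining `(v, 0)` to `L_x` keeps it isotropic, so
maximality puts `(v, 0)` in `L_x`. -/
theorem dualCoannihilator_covectorRange {L : ∀ x : M, Submodule ℝ (GenTangentSpace E x)} {x : M}
    (hL : Maximal IsIsotropic (L x)) :
    (covectorRange L x).dualCoannihilator = charDistribution L x := by
  ext v
  rw [Submodule.mem_dualCoannihilator]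
  constructor
  · intro hv
    have hv' : ∀ u ∈ L x, u.2 v = 0 := fun u hu =>
      hv _ (Submodule.mem_map_of_mem hu)
    let v₀ : GenTangentSpace E x := (v, 0)
    have hiso : IsIsotropic (L x ⊔ Submodule.span ℝ {v₀}) := by
      intro u hu w hw
      obtain ⟨u₁, hu₁, u₂, hu₂, rfl⟩ := Submodule.mem_sup.1 hu
      obtain ⟨w₁, hw₁, w₂, hw₂, rfl⟩ := Submodule.mem_sup.1 hw
      obtain ⟨a, rfl⟩ := Submodule.mem_span_singleton.1 hu₂
      obtain ⟨b, rfl⟩ := Submodule.mem_span_singleton.1 hw₂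
      have h := hL.prop.apply_add_apply hu₁ hw₁
      simp [symmPairing, v₀, hv' u₁ hu₁, hv' w₁ hw₁, h]
    exact hL.le_of_ge hiso le_sup_left
      (Submodule.mem_sup_right (Submodule.mem_span_singleton_self v₀))
  · rintro hv _ ⟨u, hu, rfl⟩
    exact hL.prop.apply_eq_zero hv hu

theorem mem_covectorRange {L : ∀ x : M, Submodule ℝ (GenTangentSpace E x)} {x : M}
    [FiniteDimensional ℝ E] (hL : Maximal IsIsotropic (L x)) {α : TangentSpace 𝓘(ℝ, E) x →L[ℝ] ℝ}
    (hα : ∀ v ∈ charDistribution L x, α v = 0) :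
    (α : TangentSpace 𝓘(ℝ, E) x →ₗ[ℝ] ℝ) ∈ covectorRange L x := by
  have : FiniteDimensional ℝ (TangentSpace 𝓘(ℝ, E) x) := inferInstanceAs (FiniteDimensional ℝ E)
  rw [← Subspace.dualCoannihilator_dualAnnihilator_eq (W := covectorRange L x),
    dualCoannihilator_covectorRange hL, Submodule.mem_dualAnnihilator]
  exact hα

/-- Transfers constancy of rank from `D_L` to the covector projection of `L`. -/
theorem finrank_covectorRange {L : ∀ x : M, Submodule ℝ (GenTangentSpace E x)} {x : M}
    [FiniteDimensional ℝ E] (hL : Maximal IsIsotropic (L x)) :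
    Module.finrank ℝ (covectorRange L x) + Module.finrank ℝ (charDistribution L x)
      = Module.finrank ℝ E := by
  have : FiniteDimensional ℝ (TangentSpace 𝓘(ℝ, E) x) := inferInstanceAs (FiniteDimensional ℝ E)
  rw [← dualCoannihilator_covectorRange hL, Subspace.finrank_add_finrank_dualCoannihilator_eq]
  rfl

theorem exists_dual_vectors {V : Type*} [AddCommGroup V] [Module ℝ V] {κ : Type*} [Fintype κ]
    [DecidableEq κ] {w : κ → Module.Dual ℝ V} (hw : LinearIndependent ℝ w) :
    ∃ e : κ → V, ∀ i j, w i (e j) = (1 : Matrix κ κ ℝ) i j := by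
  let b : (κ → ℝ) →ₗ[ℝ] V →ₗ[ℝ] ℝ := Fintype.linearCombination ℝ w
  have hb : Function.Surjective b.flip := by
    rw [LinearMap.flip_surjective_iff₁]
    exact hw.fintypeLinearCombination_injective
  choose e he using fun j => hb (LinearMap.proj j)
  refine ⟨e, fun i j => ?_⟩
  have := congrArg (fun f => f (Pi.single i 1)) (he j)
  simpa [b, Fintype.linearCombination_apply_single, Matrix.one_apply, Pi.single_apply, eq_comm]
    using this

/-- Cramer's rule shows that the solution of a linear system depends smoothly on its entries. -/
theorem cramer_mulVec {κ : Type*} [Fintype κ] [DecidableEq κ] (G : Matrix κ κ ℝ)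
    (hG : G.det ≠ 0) (c : κ → ℝ) (i : κ) :
    (G.det)⁻¹ * (G.updateCol i (G.mulVec c)).det = c i := by
  rw [← Matrix.cramer_apply, Matrix.cramer_eq_adjugate_mulVec, Matrix.mulVec_mulVec,
    Matrix.adjugate_mul, Matrix.smul_mulVec, Matrix.one_mulVec, Pi.smul_apply, smul_eq_mul,
    inv_mul_cancel_left₀ hG]

theorem contMDiffOn_det {κ : Type*} [Fintype κ] [DecidableEq κ] {G : M → Matrix κ κ ℝ} {U : Set M}
    (hG : ∀ i j, ContMDiffOn 𝓘(ℝ, E) 𝓘(ℝ, ℝ) ∞ (fun x => G x i j) U) :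
    ContMDiffOn 𝓘(ℝ, E) 𝓘(ℝ, ℝ) ∞ (fun x => (G x).det) U := by
  simp only [Matrix.det_apply']
  refine contMDiffOn_finsetSum fun σ _ => contMDiffOn_const.mul ?_
  exact contMDiffOn_finsetProd fun i _ => hG _ _

end LinearAlgebra

/-! ### Existence of Hamiltonian vector fields. -/

section Hamiltonian

variable {E : Type*} [NormedAddCommGroup E] [NormedSpace ℝ E] [FiniteDimensional ℝ E]
  {M : Type*} [TopologicalSpace M] [ChartedSpace E M] [IsManifold 𝓘(ℝ, E) ∞ M]
  [T2Space M] [SecondCountableTopology M]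

/-- A smooth 1-form that annihilates the characteristic distribution, which has constant rank, is
locally the covector part of a smooth section of `L`. -/
theorem exists_local_vectorField {L : ∀ x : M, Submodule ℝ (GenTangentSpace E x)}
    (hsub : IsSubbundle L) (hL : ∀ x, Maximal IsIsotropic (L x)) {r : ℕ}
    (hr : ∀ x, Module.finrank ℝ (charDistribution L x) = r)
    {β : ∀ x : M, TangentSpace 𝓘(ℝ, E) x →L[ℝ] ℝ} (hβ : SmoothOneFormOn β Set.univ)
    (hβL : ∀ x, ∀ v ∈ charDistribution L x, β x v = 0) (x₀ : M) :
    ∃ U ∈ 𝓝 x₀, ∃ X : ∀ x : M, TangentSpace 𝓘(ℝ, E) x,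
      SmoothVectorFieldOn X U ∧ ∀ x ∈ U, (X x, β x) ∈ L x := by
  classical
  obtain ⟨U, hU, k, Y, α, hY, hα, hfr⟩ := hsub x₀
  let w : ∀ x : M, Fin k → Module.Dual ℝ (TangentSpace 𝓘(ℝ, E) x) := fun x i => (α i x).toLinearMap
  have hw : ∀ x ∈ U, Submodule.span ℝ (Set.range (w x)) = covectorRange L x := by
    intro x hx
    rw [covectorRange, ← (hfr x hx).2, Submodule.map_span, ← Set.range_comp]
    rfl
  have hwmem : ∀ x ∈ U, ∀ i, (Y i x, α i x) ∈ L x := by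
    intro x hx i
    rw [← (hfr x hx).2]
    exact Submodule.subset_span ⟨i, rfl⟩
  -- The covector parts of a frame of `L` may be dependent; keep those forming a basis of their span
  -- at `x₀`.
  obtain ⟨κ, a, ha, hspan, hli⟩ := exists_linearIndependent' ℝ (w x₀)
  have : Fintype κ := Fintype.ofInjective a ha
  have hx₀ : x₀ ∈ U := mem_of_mem_nhds hU
  have hcard : ∀ x, Module.finrank ℝ (covectorRange L x) = Fintype.card κ := by
    intro x
    rw [← finrank_span_eq_card hli, hspan, hw x₀ hx₀]
    have h₁ := finrank_covectorRange (hL x)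
    have h₂ := finrank_covectorRange (hL x₀)
    rw [hr] at h₁ h₂
    omega
  obtain ⟨e, he⟩ := exists_dual_vectors hli
  choose W hW hWe using fun j => exists_smoothVectorField_apply_eq (e j)
  -- The fields `W j` extend vectors dual to the chosen covectors, so `G x₀` is the identity and `G`
  -- stays invertible nearby.
  let G : M → Matrix κ κ ℝ := fun x => Matrix.of fun j i => α (a i) x (W j x)
  let b : M → κ → ℝ := fun x j => β x (W j x)
  have hG : ∀ j i, ContMDiffOn 𝓘(ℝ, E) 𝓘(ℝ, ℝ) ∞ (fun x => G x j i) U := fun j i =>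
    contMDiffOn_oneForm_apply (hα (a i)) ((hW j).mono (Set.subset_univ U))
  have hb : ∀ j, ContMDiffOn 𝓘(ℝ, E) 𝓘(ℝ, ℝ) ∞ (fun x => b x j) U := fun j =>
    (contMDiffOn_oneForm_apply hβ (hW j)).mono (Set.subset_univ U)
  have hdet : ContMDiffOn 𝓘(ℝ, E) 𝓘(ℝ, ℝ) ∞ (fun x => (G x).det) U := contMDiffOn_det hG
  have hG₀ : (G x₀).det = 1 := by
    have : G x₀ = (1 : Matrix κ κ ℝ).transpose := by
      ext j i
      rw [Matrix.transpose_apply, ← he i j, ← hWe j]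
      rfl
    rw [this, Matrix.det_transpose, Matrix.det_one]
  let U' : Set M := {x ∈ U | (G x).det ≠ 0}
  have hU' : U' ∈ 𝓝 x₀ := by
    refine Filter.inter_mem hU ?_
    refine (hdet.contMDiffAt hU).continuousAt.eventually_ne ?_
    rw [hG₀]
    exact one_ne_zero
  have hU'U : U' ⊆ U := fun x hx => hx.1
  let c : M → κ → ℝ := fun x i => (G x).det⁻¹ * ((G x).updateCol i (b x)).det
  have hc : ∀ i, ContMDiffOn 𝓘(ℝ, E) 𝓘(ℝ, ℝ) ∞ (fun x => c x i) U' := by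
    intro i
    refine ((hdet.mono hU'U).inv₀ fun x hx => hx.2).mul (contMDiffOn_det fun j l => ?_)
    by_cases hli : l = i
    · subst hli
      simpa using (hb j).mono hU'U
    · simpa [Matrix.updateCol_apply, hli] using (hG j l).mono hU'U
  have hβc : ∀ x ∈ U', β x = ∑ i, c x i • α (a i) x := by
    intro x hx
    have hlix : LinearIndependent ℝ (w x ∘ a) := by
      rw [Fintype.linearIndependent_iff]
      intro g hg
      have : (G x).mulVec g = 0 := by
        ext j
        have := congrArg (fun f => f (W j x)) hg
        simpa [Matrix.mulVec, dotProduct, G, w, mul_comm] using this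
      exact congrFun (Matrix.eq_zero_of_mulVec_eq_zero hx.2 this)
    have hle : Submodule.span ℝ (Set.range (w x ∘ a)) ≤ covectorRange L x := by
      rw [← hw x hx.1]
      exact Submodule.span_mono (Set.range_comp_subset_range a (w x))
    have : FiniteDimensional ℝ (TangentSpace 𝓘(ℝ, E) x) :=
      inferInstanceAs (FiniteDimensional ℝ E)
    have hmem := mem_covectorRange (hL x) (hβL x)
    -- Constant rank enters here: the chosen covectors, still independent at `x`, are numerous
    -- enough to span all covector parts of `L x`.
    rw [← Submodule.eq_of_le_of_finrank_eq hle
      ((finrank_span_eq_card hlix).trans (hcard x).symm),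
      Submodule.mem_span_range_iff_exists_fun] at hmem
    obtain ⟨d, hd⟩ := hmem
    have hβd : β x = ∑ i, d i • α (a i) x := by
      ext v
      have := congrArg (fun f => f v) hd
      simpa [w] using this.symm
    have hbd : b x = (G x).mulVec d := by
      ext j
      simp [b, hβd, Matrix.mulVec, dotProduct, G, mul_comm]
    have hcd : c x = d := by
      ext i
      simp only [c, hbd]
      exact cramer_mulVec _ hx.2 d i
    rw [hcd, hβd]
  refine ⟨U', hU', fun x => ∑ i, c x i • Y (a i) x, ?_, ?_⟩
  · exact ContMDiffOn.sum_section fun i _ => (hc i).smul_section ((hY (a i)).mono hU'U)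
  · intro x hx
    rw [hβc x hx]
    have : ((∑ i, c x i • Y (a i) x, ∑ i, c x i • α (a i) x) : GenTangentSpace E x)
        = ∑ i, c x i • ((Y (a i) x, α (a i) x) : GenTangentSpace E x) := by
      ext1 <;> simp [Prod.fst_sum, Prod.snd_sum]
    rw [this]
    exact Submodule.sum_mem _ fun i _ => Submodule.smul_mem _ _ (hwmem x hx.1 (a i))

/-- The vectors `v` with `(v, df) ∈ L_x` form a convex set, so local solutions glue. -/
theorem exists_isHamiltonian {L : ∀ x : M, Submodule ℝ (GenTangentSpace E x)}
    (hL : IsDirac L) {r : ℕ} (hr : ∀ x, Module.finrank ℝ (charDistribution L x) = r)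
    {f : M → ℝ} (hf : ContMDiff 𝓘(ℝ, E) 𝓘(ℝ, ℝ) ∞ f)
    (hfL : ∀ x, ∀ v ∈ charDistribution L x, dAt E f x v = 0) : ∃ X, IsHamiltonian L X f := by
  have : LocallyCompactSpace M := ChartedSpace.locallyCompactSpace E M
  let t : ∀ x : M, Set (TangentSpace 𝓘(ℝ, E) x) := fun x => {v | (v, dAt E f x) ∈ L x}
  have ht : ∀ x, Convex ℝ (t x) := by
    intro x v hv w hw p q _ _ hpq
    have := (L x).add_mem ((L x).smul_mem p hv) ((L x).smul_mem q hw)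
    simp only [Prod.smul_mk, Prod.mk_add_mk, ← add_smul, hpq, one_smul] at this
    exact this
  obtain ⟨s, hs⟩ := exists_contMDiffSection_forall_mem_convex_of_local 𝓘(ℝ, E)
    (F_fiber := E) (n := ⊤) (fun x : M => TangentSpace 𝓘(ℝ, E) x) t ht
    (exists_local_vectorField hL.subbundle hL.maximal_isotropic hr (smoothOneFormOn_dAt hf) hfL)
  exact ⟨s, s.contMDiff.contMDiffOn, hs⟩

end Hamiltonian

/-! ### Courant brackets of Hamiltonian sections. -/

section HamiltonianBracket

variable {E : Type*} [NormedAddCommGroup E] [NormedSpace ℝ E] [FiniteDimensional ℝ E]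
  {M : Type*} [TopologicalSpace M] [ChartedSpace E M] [IsManifold 𝓘(ℝ, E) ∞ M]
  {L : ∀ x : M, Submodule ℝ (GenTangentSpace E x)}

omit [FiniteDimensional ℝ E] in
theorem IsHamiltonian.isSection {X : ∀ x : M, TangentSpace 𝓘(ℝ, E) x} {f : M → ℝ}
    (hX : IsHamiltonian L X f) (hf : ContMDiff 𝓘(ℝ, E) 𝓘(ℝ, ℝ) ∞ f) :
    IsSection L X (dAt E f) :=
  ⟨hX.1, smoothOneFormOn_dAt hf, hX.2⟩

/-- Cartan's identity `L_X df = d(X f)`, from the commutator formula for `[X, W]`. -/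
theorem lieDerivForm_dAt {f : M → ℝ} (hf : ContMDiff 𝓘(ℝ, E) 𝓘(ℝ, ℝ) ∞ f)
    {X W : ∀ x : M, TangentSpace 𝓘(ℝ, E) x} (hX : SmoothVectorFieldOn X Set.univ)
    (hW : SmoothVectorFieldOn W Set.univ) (x : M) :
    lieDerivForm X (dAt E f) W x = dAt E (fun y => dAt E f y (X y)) x (W x) := by
  have : CompleteSpace E := FiniteDimensional.complete ℝ E
  rw [lieDerivForm, dAt_mlieBracket hf hX hW, sub_sub_cancel]

omit [FiniteDimensional ℝ E] in
theorem IsHamiltonian.dAt_apply_swap (hL : ∀ x, IsIsotropic (L x))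
    {X Y : ∀ x : M, TangentSpace 𝓘(ℝ, E) x} {f g : M → ℝ}
    (hX : IsHamiltonian L X f) (hY : IsHamiltonian L Y g) (x : M) :
    dAt E f x (Y x) = -dAt E g x (X x) :=
  eq_neg_of_add_eq_zero_right ((hL x).apply_add_apply (hX.2 x) (hY.2 x))

/-- The Lie bracket of the Hamiltonian vector fields of `f` and `g` is a Hamiltonian vector field
of `X_f g`. -/
theorem IsHamiltonian.mlieBracket_mem [T2Space M] [SecondCountableTopology M] (hL : IsDirac L)
    {X Y : ∀ x : M, TangentSpace 𝓘(ℝ, E) x} {f g : M → ℝ}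
    (hX : IsHamiltonian L X f) (hY : IsHamiltonian L Y g)
    (hf : ContMDiff 𝓘(ℝ, E) 𝓘(ℝ, ℝ) ∞ f) (hg : ContMDiff 𝓘(ℝ, E) 𝓘(ℝ, ℝ) ∞ g) (x : M) :
    (VectorField.mlieBracket 𝓘(ℝ, E) X Y x, dAt E (fun y => dAt E g y (X y)) x) ∈ L x := by
  obtain ⟨γ, hγ, hmem⟩ := hL.integrable X _ Y _ (hX.isSection hf) (hY.isSection hg) x
  convert hmem using 2
  ext v
  obtain ⟨W, hW, rfl⟩ := exists_smoothVectorField_apply_eq v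
  let h : M → ℝ := fun y => dAt E g y (X y)
  have hh : ContMDiff 𝓘(ℝ, E) 𝓘(ℝ, ℝ) ∞ h := contMDiff_dAt_apply hg hX.1
  -- Isotropy gives `Y f = -X g = -h`, so the three terms of the Courant form are `dh`, `+dh` and
  -- `-dh`, with sum `dh`.
  have hfY : (fun y => dAt E f y (Y y)) = (-1 : ℝ) • h := by
    ext y
    simp [h, hX.dAt_apply_swap (fun x => (hL.maximal_isotropic x).prop) hY y]
  have hsub : (fun y => dAt E f y (Y y) - dAt E g y (X y)) = (-2 : ℝ) • h := by
    ext y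
    have := congrFun hfY y
    simp only [h, Pi.smul_apply, smul_eq_mul] at this ⊢
    rw [this]
    ring
  have hd : MDifferentiableAt 𝓘(ℝ, E) 𝓘(ℝ, ℝ) h x := hh.mdifferentiableAt (by simp)
  rw [hγ W hW, courantForm, lieDerivForm_dAt hg hX.1 hW, lieDerivForm_dAt hf hY.1 hW, hfY, hsub,
    dAt_const_smul hd, dAt_const_smul hd]
  change dAt E h x (W x) = dAt E h x (W x) - (-1) * dAt E h x (W x)
    + 1 / 2 * ((-2) * dAt E h x (W x))
  ring

end HamiltonianBracket

/-! ### The reduced Poisson structure. -/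

section Reduction

variable {E : Type*} [NormedAddCommGroup E] [NormedSpace ℝ E]
  {M : Type*} [TopologicalSpace M] [ChartedSpace E M]
  {L : ∀ x : M, Submodule ℝ (GenTangentSpace E x)}
  {B : Type*} [NormedAddCommGroup B] [NormedSpace ℝ B]
  [ChartedSpace B (LeafSpace L)]

theorem IsReducible.contMDiff_leafProj (hred : IsReducible (B := B) L) :
    ContMDiff 𝓘(ℝ, E) 𝓘(ℝ, B) ∞ (leafProj L) :=
  hred.submersion.contMDiff

theorem IsReducible.contMDiff_comp (hred : IsReducible (B := B) L)
    (f : C^∞⟮𝓘(ℝ, B), LeafSpace L; ℝ⟯) :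
    ContMDiff 𝓘(ℝ, E) 𝓘(ℝ, ℝ) ∞ (f ∘ leafProj L) :=
  f.contMDiff.comp hred.contMDiff_leafProj

theorem IsReducible.mdifferentiableAt_comp (hred : IsReducible (B := B) L)
    (f : C^∞⟮𝓘(ℝ, B), LeafSpace L; ℝ⟯) (x : M) :
    MDifferentiableAt 𝓘(ℝ, E) 𝓘(ℝ, ℝ) (f ∘ leafProj L) x :=
  (hred.contMDiff_comp f).mdifferentiableAt (by simp)

theorem IsReducible.dAt_comp (hred : IsReducible (B := B) L)
    (f : C^∞⟮𝓘(ℝ, B), LeafSpace L; ℝ⟯) (x : M) :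
    dAt E (f ∘ leafProj L) x
      = (dAt B f (leafProj L x)).comp (mfderiv 𝓘(ℝ, E) 𝓘(ℝ, B) (leafProj L) x) :=
  dAt_comp_apply (mdiffAt f _) (hred.contMDiff_leafProj.mdifferentiableAt (by simp))

theorem IsReducible.dAt_comp_eq_zero (hred : IsReducible (B := B) L)
    (f : C^∞⟮𝓘(ℝ, B), LeafSpace L; ℝ⟯) (x : M) (v : TangentSpace 𝓘(ℝ, E) x)
    (hv : v ∈ charDistribution L x) : dAt E (f ∘ leafProj L) x v = 0 := by
  rw [hred.dAt_comp, ContinuousLinearMap.comp_apply, (hred.ker_eq x v).2 hv, map_zero]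

/-- Two such vectors differ by an element of `D_L`; hence the bracket does not depend on the
Hamiltonian vector field chosen. -/
theorem IsReducible.dAt_comp_congr (hred : IsReducible (B := B) L)
    (g : C^∞⟮𝓘(ℝ, B), LeafSpace L; ℝ⟯) {x : M} {α : TangentSpace 𝓘(ℝ, E) x →L[ℝ] ℝ}
    {v w : TangentSpace 𝓘(ℝ, E) x} (hv : (v, α) ∈ L x) (hw : (w, α) ∈ L x) :
    dAt E (g ∘ leafProj L) x v = dAt E (g ∘ leafProj L) x w := by
  have hvw : v - w ∈ charDistribution L x := by
    have := (L x).sub_mem hv hw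
    rwa [Prod.mk_sub_mk, sub_self] at this
  rw [← sub_eq_zero, ← map_sub]
  exact hred.dAt_comp_eq_zero g x _ hvw

theorem IsReducible.exists_descent (hred : IsReducible (B := B) L) {h : M → ℝ}
    (hh : ContMDiff 𝓘(ℝ, E) 𝓘(ℝ, ℝ) ∞ h)
    (hd : ∀ x, ∀ v ∈ charDistribution L x, dAt E h x v = 0) :
    ∃ k : C^∞⟮𝓘(ℝ, B), LeafSpace L; ℝ⟯, ∀ x, k (leafProj L x) = h x :=
  ⟨⟨Quotient.lift h fun _ _ hxy => eq_of_leafSetoid hh hd hxy,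
    contMDiff_of_comp_submersion hred.submersion (leafProj_surjective L) hh⟩, fun _ => rfl⟩

theorem IsReducedPoisson.eq [IsManifold 𝓘(ℝ, E) ∞ M]
    {P P' : PoissonStructure B (LeafSpace L)} (hP : IsReducedPoisson L P)
    (hP' : IsReducedPoisson L P') : P = P' := by
  ext f g y
  obtain ⟨x, rfl⟩ := leafProj_surjective L y
  obtain ⟨X, hX⟩ := (hP f).1
  exact ((hP f).2 X hX g x).trans ((hP' f).2 X hX g x).symm

variable [IsManifold 𝓘(ℝ, E) ∞ M] [FiniteDimensional ℝ E] [T2Space M]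
  [SecondCountableTopology M]

theorem IsReducible.exists_isHamiltonian (hL : IsDirac L) (hred : IsReducible (B := B) L)
    (f : C^∞⟮𝓘(ℝ, B), LeafSpace L; ℝ⟯) : ∃ X, IsHamiltonian L X (f ∘ leafProj L) := by
  obtain ⟨r, hr⟩ := hred.regular
  exact DiracGeometry.exists_isHamiltonian hL hr (hred.contMDiff_comp f) (hred.dAt_comp_eq_zero f)

/-- `d(X_f g)` is the covector part of an element of `L`, so by isotropy it kills `D_L` and `X_f g`
descends. -/
theorem IsReducible.exists_bracket (hL : IsDirac L) (hred : IsReducible (B := B) L)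
    (f g : C^∞⟮𝓘(ℝ, B), LeafSpace L; ℝ⟯) :
    ∃ k : C^∞⟮𝓘(ℝ, B), LeafSpace L; ℝ⟯, ∀ X, IsHamiltonian L X (f ∘ leafProj L) →
      ∀ x, k (leafProj L x) = dAt E (g ∘ leafProj L) x (X x) := by
  obtain ⟨X, hX⟩ := hred.exists_isHamiltonian hL f
  obtain ⟨Y, hY⟩ := hred.exists_isHamiltonian hL g
  obtain ⟨k, hk⟩ := hred.exists_descent (contMDiff_dAt_apply (hred.contMDiff_comp g) hX.1)
    fun x v hv => (hL.maximal_isotropic x).prop.apply_eq_zero hv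
      (hX.mlieBracket_mem hL hY (hred.contMDiff_comp f) (hred.contMDiff_comp g) x)
  exact ⟨k, fun X' hX' x => (hk x).trans (hred.dAt_comp_congr g (hX.2 x) (hX'.2 x))⟩

/-- The reduced bracket of two functions on the leaf space. -/
noncomputable def reducedBracket (hL : IsDirac L) (hred : IsReducible (B := B) L)
    (f g : C^∞⟮𝓘(ℝ, B), LeafSpace L; ℝ⟯) : C^∞⟮𝓘(ℝ, B), LeafSpace L; ℝ⟯ :=
  (hred.exists_bracket hL f g).choose

/-- Only a vector at `x` is needed, not a Hamiltonian field: sums of Hamiltonian vectors and values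
of Lie brackets can be inserted directly. -/
theorem reducedBracket_apply (hL : IsDirac L) (hred : IsReducible (B := B) L)
    (f g : C^∞⟮𝓘(ℝ, B), LeafSpace L; ℝ⟯) {x : M} {v : TangentSpace 𝓘(ℝ, E) x}
    (hv : (v, dAt E (f ∘ leafProj L) x) ∈ L x) :
    reducedBracket hL hred f g (leafProj L x) = dAt E (g ∘ leafProj L) x v := by
  obtain ⟨X, hX⟩ := hred.exists_isHamiltonian hL f
  exact ((hred.exists_bracket hL f g).choose_spec X hX x).trans
    (hred.dAt_comp_congr g (hX.2 x) hv)

theorem exists_reducedPoisson (hL : IsDirac L) (hred : IsReducible (B := B) L) :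
    ∃ P : PoissonStructure B (LeafSpace L), IsReducedPoisson L P := by
  have hadd : ∀ (f g : C^∞⟮𝓘(ℝ, B), LeafSpace L; ℝ⟯) (x : M),
      dAt E (⇑(f + g) ∘ leafProj L) x
        = dAt E (f ∘ leafProj L) x + dAt E (g ∘ leafProj L) x := fun f g x =>
    dAt_add (hred.mdifferentiableAt_comp f x) (hred.mdifferentiableAt_comp g x)
  have hsmul : ∀ (c : ℝ) (f : C^∞⟮𝓘(ℝ, B), LeafSpace L; ℝ⟯) (x : M),
      dAt E (⇑(c • f) ∘ leafProj L) x = c • dAt E (f ∘ leafProj L) x := fun c f x =>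
    dAt_const_smul (hred.mdifferentiableAt_comp f x) c
  have hext : ∀ f g : C^∞⟮𝓘(ℝ, B), LeafSpace L; ℝ⟯,
      (∀ x, f (leafProj L x) = g (leafProj L x)) → f = g := by
    intro f g h
    ext y
    obtain ⟨x, rfl⟩ := leafProj_surjective L y
    exact h x
  have hiso : ∀ x, IsIsotropic (L x) := fun x => (hL.maximal_isotropic x).prop
  choose X hX using hred.exists_isHamiltonian hL
  have hb : ∀ f g x, reducedBracket hL hred f g (leafProj L x)
      = dAt E (g ∘ leafProj L) x (X f x) := fun f g x =>
    reducedBracket_apply hL hred f g ((hX f).2 x)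
  have hcomp : ∀ f g, reducedBracket hL hred f g ∘ leafProj L
      = fun x => dAt E (g ∘ leafProj L) x (X f x) := fun f g => funext (hb f g)
  have hskew : ∀ f g, reducedBracket hL hred f g = -reducedBracket hL hred g f := by
    refine fun f g => hext _ _ fun x => ?_
    rw [ContMDiffMap.coe_neg, Pi.neg_apply, hb, hb]
    exact (hX g).dAt_apply_swap hiso (hX f) x
  -- Jacobi in commutator form: `[X_f, X_g]` is pointwise Hamiltonian for `{f, g}` and acts as the
  -- commutator of derivations.
  have hjac : ∀ f g k, reducedBracket hL hred (reducedBracket hL hred f g) k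
      = reducedBracket hL hred f (reducedBracket hL hred g k)
        - reducedBracket hL hred g (reducedBracket hL hred f k) := by
    refine fun f g k => hext _ _ fun x => ?_
    have hmem := (hX f).mlieBracket_mem hL (hX g) (hred.contMDiff_comp f) (hred.contMDiff_comp g) x
    rw [← hcomp f g] at hmem
    have : CompleteSpace E := FiniteDimensional.complete ℝ E
    rw [reducedBracket_apply hL hred _ k hmem, ContMDiffMap.coe_sub, Pi.sub_apply, hb, hb, hcomp,
      hcomp, dAt_mlieBracket (hred.contMDiff_comp k) (hX f).1 (hX g).1]
  let β : C^∞⟮𝓘(ℝ, B), LeafSpace L; ℝ⟯ →ₗ[ℝ] C^∞⟮𝓘(ℝ, B), LeafSpace L; ℝ⟯ →ₗ[ℝ]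
      C^∞⟮𝓘(ℝ, B), LeafSpace L; ℝ⟯ :=
    LinearMap.mk₂ ℝ (reducedBracket hL hred)
      (fun f f' g => hext _ _ fun x => by
        have hmem := (L x).add_mem ((hX f).2 x) ((hX f').2 x)
        rw [Prod.mk_add_mk, ← hadd] at hmem
        rw [reducedBracket_apply hL hred _ g hmem, map_add, ContMDiffMap.coe_add, Pi.add_apply,
          hb, hb])
      (fun c f g => hext _ _ fun x => by
        have hmem := (L x).smul_mem c ((hX f).2 x)
        rw [Prod.smul_mk, ← hsmul] at hmem
        rw [reducedBracket_apply hL hred _ g hmem, map_smul, ContMDiffMap.coe_smul, Pi.smul_apply,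
          hb])
      (fun f g g' => hext _ _ fun x => by
        rw [ContMDiffMap.coe_add, Pi.add_apply, hb, hb, hb, hadd]
        rfl)
      (fun c f g => hext _ _ fun x => by
        rw [ContMDiffMap.coe_smul, Pi.smul_apply, hb, hb, hsmul]
        rfl)
  refine ⟨⟨β, hskew, fun f g k => hext _ _ fun x => ?_, fun f g k => ?_⟩, fun f => ⟨⟨X f, hX f⟩,
    fun Y hY g x => reducedBracket_apply hL hred f g (hY.2 x)⟩⟩
  · change reducedBracket hL hred f (g * k) (leafProj L x)
      = reducedBracket hL hred f g (leafProj L x) * k (leafProj L x)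
        + g (leafProj L x) * reducedBracket hL hred f k (leafProj L x)
    rw [hb, hb, hb]
    exact dAt_mul_apply (hred.mdifferentiableAt_comp g x) (hred.mdifferentiableAt_comp k x) _
  · change reducedBracket hL hred f (reducedBracket hL hred g k)
      + reducedBracket hL hred g (reducedBracket hL hred k f)
      + reducedBracket hL hred k (reducedBracket hL hred f g) = 0
    have hneg : reducedBracket hL hred g (reducedBracket hL hred k f)
        = -reducedBracket hL hred g (reducedBracket hL hred f k) := by
      rw [hskew k f]
      exact (β g).map_neg _
    rw [hneg, hskew k (reducedBracket hL hred f g), hjac]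
    abel

theorem existsUnique_reducedPoisson
    (hL : IsDirac L)
    (hred : IsReducible (B := B) L) :
    ∃! P : PoissonStructure B (LeafSpace L), IsReducedPoisson L P :=
  (exists_reducedPoisson hL hred).imp fun _ hP => ⟨hP, fun _ hP' => hP'.eq hP⟩

end Reduction

/-! ### The Dirac structure as a pullback of the Poisson graph. -/

section Graph

variable {E : Type*} [NormedAddCommGroup E] [NormedSpace ℝ E]
  {M : Type*} [TopologicalSpace M] [ChartedSpace E M] [IsManifold 𝓘(ℝ, E) ∞ M]
  {L : ∀ x : M, Submodule ℝ (GenTangentSpace E x)}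
  {B : Type*} [NormedAddCommGroup B] [NormedSpace ℝ B] [FiniteDimensional ℝ B]
  [ChartedSpace B (LeafSpace L)] [T2Space (LeafSpace L)] [IsManifold 𝓘(ℝ, B) ∞ (LeafSpace L)]

/-- The Dirac structure is the backward image of the graph of the reduced Poisson structure: in
terms of vectors `v` at `x` and covectors `β` at `p(x)`. -/
theorem IsReducedPoisson.mem_graph_iff (hred : IsReducible (B := B) L)
    {P : PoissonStructure B (LeafSpace L)} (hP : IsReducedPoisson L P) {x : M}
    (v : TangentSpace 𝓘(ℝ, E) x) (β : TangentSpace 𝓘(ℝ, B) (leafProj L x) →L[ℝ] ℝ) :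
    (mfderiv 𝓘(ℝ, E) 𝓘(ℝ, B) (leafProj L) x v, β) ∈ P.graph (leafProj L x) ↔
      (v, β.comp (mfderiv 𝓘(ℝ, E) 𝓘(ℝ, B) (leafProj L) x)) ∈ L x := by
  constructor
  · rintro ⟨f, rfl, hf⟩
    obtain ⟨X, hX⟩ := (hP f).1
    -- Differentials of smooth functions separate tangent vectors of the leaf space, and `v`, `X x`
    -- give every `g ∘ p` the same derivative.
    have hker : v - X x ∈ charDistribution L x := by
      rw [← hred.ker_eq, map_sub, sub_eq_zero]
      by_contra hne
      have hne' := sub_ne_zero.2 hne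
      obtain ⟨η, hη⟩ := SeparatingDual.exists_ne_zero (R := ℝ)
        (V := B) hne'
      obtain ⟨g, hg⟩ := exists_smooth_dAt_eq (E := B) (x := leafProj L x) η
      refine hη ?_
      have h₁ := hf g
      rw [(hP f).2 X hX g x, hred.dAt_comp] at h₁
      rw [← hg]
      exact (map_sub (dAt B g (leafProj L x)) _ _).trans (sub_eq_zero.2 h₁)
    have := (L x).add_mem (mem_charDistribution.1 hker) (hX.2 x)
    rwa [Prod.mk_add_mk, sub_add_cancel, zero_add, hred.dAt_comp] at this
  · intro hv
    obtain ⟨f, rfl⟩ := exists_smooth_dAt_eq β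
    rw [← hred.dAt_comp] at hv
    obtain ⟨X, hX⟩ := (hP f).1
    refine ⟨f, rfl, fun g => ?_⟩
    rw [(hP f).2 X hX g x, ← hred.dAt_comp_congr g hv (hX.2 x), hred.dAt_comp]
    rfl

theorem IsReducedPoisson.mem_iff (hred : IsReducible (B := B) L)
    (hL : ∀ x, IsIsotropic (L x)) {P : PoissonStructure B (LeafSpace L)}
    (hP : IsReducedPoisson L P) {x : M} (v : TangentSpace 𝓘(ℝ, E) x)
    (α : TangentSpace 𝓘(ℝ, E) x →L[ℝ] ℝ) :
    (v, α) ∈ L x ↔ ∃ β : TangentSpace 𝓘(ℝ, B) (leafProj L x) →L[ℝ] ℝ,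
      α = β.comp (mfderiv 𝓘(ℝ, E) 𝓘(ℝ, B) (leafProj L) x) ∧
      (mfderiv 𝓘(ℝ, E) 𝓘(ℝ, B) (leafProj L) x v, β) ∈ P.graph (leafProj L x) := by
  constructor
  · intro hv
    have hsurj := mfderiv_surjective_of_isSubmersionAt (hred.submersion.isSubmersionAt x)
    -- Any linear right inverse of `p_*` serves: `α` kills `ker p_* = D_L`, so `α ∘ σ` pulls back to
    -- `α`.
    obtain ⟨σ, hσ⟩ := LinearMap.exists_rightInverse_of_surjective
      (mfderiv 𝓘(ℝ, E) 𝓘(ℝ, B) (leafProj L) x).toLinearMap (LinearMap.range_eq_top.2 hsurj)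
    have hσ' : ∀ w, mfderiv 𝓘(ℝ, E) 𝓘(ℝ, B) (leafProj L) x (σ w) = w := fun w =>
      congrArg (fun A => A w) hσ
    let l : B →ₗ[ℝ] ℝ := α.toLinearMap.comp σ
    obtain ⟨β, hβσ⟩ : ∃ β : TangentSpace 𝓘(ℝ, B) (leafProj L x) →L[ℝ] ℝ, ∀ w, β w = α (σ w) :=
      ⟨(LinearMap.toContinuousLinearMap l : B →L[ℝ] ℝ), fun _ => rfl⟩
    have hβ : α = β.comp (mfderiv 𝓘(ℝ, E) 𝓘(ℝ, B) (leafProj L) x) := by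
      ext u
      rw [ContinuousLinearMap.comp_apply, hβσ, ← sub_eq_zero, ← map_sub]
      refine (hL x).apply_eq_zero (u := (v, α)) ?_ hv
      rw [← hred.ker_eq, map_sub, hσ', sub_self]
    refine ⟨β, hβ, (hP.mem_graph_iff hred _ _).2 ?_⟩
    rw [hβ] at hv
    exact hv
  · rintro ⟨β, rfl, hβ⟩
    exact (hP.mem_graph_iff hred _ _).1 hβ

end Graph

/-! ### The induced map between leaf spaces. -/

section InducedMap

variable {E : Type*} [NormedAddCommGroup E] [NormedSpace ℝ E]
  {M : Type*} [TopologicalSpace M] [ChartedSpace E M]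
  {F : Type*} [NormedAddCommGroup F] [NormedSpace ℝ F]
  {N : Type*} [TopologicalSpace N] [ChartedSpace F N]
  {L : ∀ x : M, Submodule ℝ (GenTangentSpace E x)}
  {K : ∀ y : N, Submodule ℝ (GenTangentSpace F y)}
  {B : Type*} [NormedAddCommGroup B] [NormedSpace ℝ B]
  [ChartedSpace B (LeafSpace L)]
  {C : Type*} [NormedAddCommGroup C] [NormedSpace ℝ C]
  [ChartedSpace C (LeafSpace K)]

theorem contMDiff_inducedMap (hLred : IsReducible (B := B) L) (hKred : IsReducible (B := C) K)
    {φ : M → N} (hφ : ContMDiff 𝓘(ℝ, E) 𝓘(ℝ, F) ∞ φ) (hleaf : PreservesLeaves L K φ) :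
    ContMDiff 𝓘(ℝ, B) 𝓘(ℝ, C) ∞ (inducedMap L K φ hleaf) :=
  contMDiff_of_comp_submersion hLred.submersion (leafProj_surjective L)
    (hKred.contMDiff_leafProj.comp hφ)

theorem isBDirac_inducedMap [IsManifold 𝓘(ℝ, E) ∞ M] [IsManifold 𝓘(ℝ, F) ∞ N]
    [FiniteDimensional ℝ B] [T2Space (LeafSpace L)] [IsManifold 𝓘(ℝ, B) ∞ (LeafSpace L)]
    [FiniteDimensional ℝ C] [T2Space (LeafSpace K)] [IsManifold 𝓘(ℝ, C) ∞ (LeafSpace K)]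
    (hLred : IsReducible (B := B) L) (hKred : IsReducible (B := C) K)
    (hK : ∀ y, IsIsotropic (K y)) {φ : M → N} (hφ : IsBDirac L K φ)
    (hleaf : PreservesLeaves L K φ) {P : PoissonStructure B (LeafSpace L)}
    {R : PoissonStructure C (LeafSpace K)} (hP : IsReducedPoisson L P)
    (hR : IsReducedPoisson K R) : IsBDirac P.graph R.graph (inducedMap L K φ hleaf) := by
  have hφ' := contMDiff_inducedMap hLred hKred hφ.smooth hleaf
  refine ⟨hφ', fun y => ?_⟩
  obtain ⟨x, rfl⟩ := leafProj_surjective L y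
  have hsurj := mfderiv_surjective_of_isSubmersionAt (hLred.submersion.isSubmersionAt x)
  have hchain : (mfderiv 𝓘(ℝ, F) 𝓘(ℝ, C) (leafProj K) (φ x)).comp (mfderiv 𝓘(ℝ, E) 𝓘(ℝ, F) φ x)
      = (mfderiv 𝓘(ℝ, B) 𝓘(ℝ, C) (inducedMap L K φ hleaf) (leafProj L x)).comp
        (mfderiv 𝓘(ℝ, E) 𝓘(ℝ, B) (leafProj L) x) := by
    have h₁ := mfderiv_comp x (hKred.contMDiff_leafProj.mdifferentiableAt (x := φ x) (by simp))
      (hφ.smooth.mdifferentiableAt (x := x) (by simp))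
    have h₂ := mfderiv_comp x (hφ'.mdifferentiableAt (x := leafProj L x) (by simp))
      (hLred.contMDiff_leafProj.mdifferentiableAt (x := x) (by simp))
    exact h₁.symm.trans h₂
  have hchain' : ∀ v, mfderiv 𝓘(ℝ, F) 𝓘(ℝ, C) (leafProj K) (φ x) (mfderiv 𝓘(ℝ, E) 𝓘(ℝ, F) φ x v)
      = mfderiv 𝓘(ℝ, B) 𝓘(ℝ, C) (inducedMap L K φ hleaf) (leafProj L x)
        (mfderiv 𝓘(ℝ, E) 𝓘(ℝ, B) (leafProj L) x v) := fun v =>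
    congrArg (fun A => A v) hchain
  ext ⟨w, β⟩
  obtain ⟨v, rfl⟩ := hsurj w
  rw [hP.mem_graph_iff hLred, hφ.eq_backwardImage x]
  constructor
  · rintro ⟨α, hα, hmem⟩
    -- The covector `α` on `N` is itself a pullback from the leaf space of `K`; this `δ` is the
    -- required witness, and surjectivity of `p_*` then reduces `β = φ̄^*δ` to the chain rule.
    obtain ⟨δ, rfl, hδ⟩ := (hR.mem_iff hKred hK _ _).1 hmem
    refine ⟨δ, ?_, ?_⟩
    · ext w
      obtain ⟨u, rfl⟩ := hsurj w
      refine (congrArg (fun A => A u) hα).trans ?_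
      exact congrArg δ (hchain' u)
    · rw [hchain'] at hδ
      exact hδ
  · rintro ⟨δ, hβ, hδ⟩
    refine ⟨δ.comp (mfderiv 𝓘(ℝ, F) 𝓘(ℝ, C) (leafProj K) (φ x)), ?_, ?_⟩
    · ext u
      refine (congrArg (fun A => A (mfderiv 𝓘(ℝ, E) 𝓘(ℝ, B) (leafProj L) x u)) hβ).trans ?_
      exact congrArg δ (hchain' u).symm
    · refine (hR.mem_graph_iff hKred _ _).1 ?_
      rw [hchain']
      exact hδ

end InducedMap

end DiracGeometry

theorem mainTheorem8
    {E : Type*} [NormedAddCommGroup E] [NormedSpace ℝ E] [FiniteDimensional ℝ E]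
    {M : Type*} [TopologicalSpace M] [T2Space M] [SecondCountableTopology M]
    [ChartedSpace E M] [IsManifold 𝓘(ℝ, E) ∞ M]
    {F : Type*} [NormedAddCommGroup F] [NormedSpace ℝ F] [FiniteDimensional ℝ F]
    {N : Type*} [TopologicalSpace N] [T2Space N] [SecondCountableTopology N]
    [ChartedSpace F N] [IsManifold 𝓘(ℝ, F) ∞ N]
    (L : ∀ x : M, Submodule ℝ (DiracGeometry.GenTangentSpace E x))
    (K : ∀ y : N, Submodule ℝ (DiracGeometry.GenTangentSpace F y))
    (hL : DiracGeometry.IsDirac L) (hK : DiracGeometry.IsDirac K)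
    {B : Type*} [NormedAddCommGroup B] [NormedSpace ℝ B] [FiniteDimensional ℝ B]
    [ChartedSpace B (DiracGeometry.LeafSpace L)] [T2Space (DiracGeometry.LeafSpace L)]
    [IsManifold 𝓘(ℝ, B) ∞ (DiracGeometry.LeafSpace L)]
    {C : Type*} [NormedAddCommGroup C] [NormedSpace ℝ C] [FiniteDimensional ℝ C]
    [ChartedSpace C (DiracGeometry.LeafSpace K)] [T2Space (DiracGeometry.LeafSpace K)]
    [IsManifold 𝓘(ℝ, C) ∞ (DiracGeometry.LeafSpace K)]
    (hLred : DiracGeometry.IsReducible (B := B) L)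
    (hKred : DiracGeometry.IsReducible (B := C) K)
    (φ : M → N) (hφ : DiracGeometry.IsBDirac L K φ)
    (hleaf : DiracGeometry.PreservesLeaves L K φ) :
    (∃! P : DiracGeometry.PoissonStructure B (DiracGeometry.LeafSpace L),
        DiracGeometry.IsReducedPoisson L P) ∧
    (∃! R : DiracGeometry.PoissonStructure C (DiracGeometry.LeafSpace K),
        DiracGeometry.IsReducedPoisson K R) ∧
    ∀ (P : DiracGeometry.PoissonStructure B (DiracGeometry.LeafSpace L))
      (R : DiracGeometry.PoissonStructure C (DiracGeometry.LeafSpace K)),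
      DiracGeometry.IsReducedPoisson L P → DiracGeometry.IsReducedPoisson K R →
        DiracGeometry.IsBDirac P.graph R.graph (DiracGeometry.inducedMap L K φ hleaf) :=
  ⟨DiracGeometry.existsUnique_reducedPoisson hL hLred,
    DiracGeometry.existsUnique_reducedPoisson hK hKred,
    fun _ _ hP hR => DiracGeometry.isBDirac_inducedMap hLred hKred
      (fun y => (hK.maximal_isotropic y).prop) hφ hleaf hP hR⟩
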